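/- Let $A,F,Q\in\mathbb R^{n\times n}$ with $F$ and $Q$ symmetric positive definite, let $F=LL^\top$ be the Cholesky factorization of $F$ ($L$ lower triangular with positive diagonal), and put $$\mathcal R(X):=A^\top X+XA-XFX+Q .$$ A real matrix is called stable if all its eigenvalues have negative real part. Assume that the numerical range $\{x^H L^{-1}AL\,x:\ x\in\mathbb C^n,\ \|x\|_2=1\}$ is contained in the open left half-plane $\{\Re z<0\}$, and let $\tilde X_0$ be symmetric positive semidefinite such that $A-F\tilde X_0$ is stable. Fix $\alpha>0$, and let $(\tilde X_k)_{k\ge 0}$ be a sequence generated by the inexact Newton–Kleinman iteration with line search and without truncation. That is, for every $k\ge 0$, with $\tilde A_k:=A-F\tilde X_k$: * $\mathrm{vec}(\widehat X_{k+1})$ is the result, in exact arithmetic, of $\overline{it}_k\in\mathbb N$ steps of GMRES with zero initial guess applied to $\tilde{\mathcal A}_k x=-\mathrm{vec}(\tilde X_kF\tilde X_k+Q)$, where $\tilde{\mathcal A}_k:=I\otimes \tilde A_k^\top+\tilde A_k^\top\otimes I$ and $\mathrm{vec}$ stacks columns; i.e. it minimizes the Euclidean norm of the residual over the Krylov space of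 dimension parameter $\overline{it}_k$ generated by $\tilde{\mathcal A}_k$ and the right-hand side; * $\lambda_k\in(0,1]$ satisfies $$\|\mathcal R((1-\lambda_k)\tilde X_k+\lambda_k\widehat X_{k+1})\|_2\le(1-\lambda_k\alpha)\,\|\mathcal R(\tilde X_k)\|_2 ;$$ * $\tilde X_{k+1}=(1-\lambda_k)\tilde X_k+\lambda_k\widehat X_{k+1}$. Let $\tilde{\mathcal L}_k:=(L^\top\otimes L^\top)\,\tilde{\mathcal A}_k\,(L^{-\top}\otimes L^{-\top})$ (so that $-(\tilde{\mathcal L}_k+\tilde{\mathcal L}_k^\top)/2$ turns out to be positive definite), let $\kappa$ be the 2-norm condition number, and assume that for all $k\ge 0$ $$\overline{it}_k\ \ge\ 2\log\!\left((1+\sqrt2)\,\frac{\kappa(F)\,\|\tilde X_kF\tilde X_k+Q\|_F}{\lambda_{\min}(Q)}\right)\Bigg/\left(-\log\!\left(1-\frac{\lambda_{\min}\big(-(\tilde{\mathcal L}_k+\tilde{\mathcal L}_k^\top)/2\big)^2}{\lambda_{\max}(\tilde{\mathcal L}_k\tilde{\mathcal L}_k^\top)}\right)\right),$$ where the right-hand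 side is read as $0$ if the argument of the last logarithm is $0$. If there is $\bar\lambda>0$ with $\lambda_k\ge\bar\lambda$ for all $k$, then $$\|\mathcal R(\tilde X_k)\|_F\to 0 \qquad\text{and}\qquad \tilde X_k\to X^*,$$ where $X^*$ is symmetric positive definite, $\mathcal R(X^*)=0$, $A-FX^*$ is stable, and $X^*$ is the unique stabilizing solution: every $Y\in\mathbb R^{n\times n}$ with $\mathcal R(Y)=0$ such that all eigenvalues of $A-FY$ have nonpositive real part equals $X^*$. -/

import Mathlib

open Filter Topology
open scoped Matrix Kronecker

namespace Riccati

noncomputable section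

/-! ### Norms and extreme eigenvalues of real matrices -/

/-- The spectral norm `‖M‖₂`: the operator norm for the Euclidean norm. -/
def specNorm {n : ℕ} (M : Matrix (Fin n) (Fin n) ℝ) : ℝ :=
  ‖Matrix.toEuclideanCLM (n := Fin n) (𝕜 := ℝ) M‖

/-- The Frobenius norm `‖M‖_F`. -/
def frobNorm {n : ℕ} (M : Matrix (Fin n) (Fin n) ℝ) : ℝ :=
  Real.sqrt (∑ i, ∑ j, M i j ^ 2)

/-- The Euclidean norm of a vector. -/
def vecNorm {ι : Type*} [Fintype ι] (v : ι → ℝ) : ℝ :=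
  Real.sqrt (∑ i, v i ^ 2)

/-- The 2-norm condition number `κ(M) = ‖M‖₂ ‖M⁻¹‖₂` (used for invertible matrices). -/
def condNumber {n : ℕ} (M : Matrix (Fin n) (Fin n) ℝ) : ℝ :=
  specNorm M * specNorm M⁻¹

/-- The smallest eigenvalue (used for symmetric matrices, whose eigenvalues are all real;
over a field the spectrum of a matrix is its finite set of eigenvalues). -/
def lambdaMin {ι : Type*} [Fintype ι] [DecidableEq ι] (M : Matrix ι ι ℝ) : ℝ :=
  sInf (spectrum ℝ M)

/-- The largest eigenvalue (used for symmetric matrices). -/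
def lambdaMax {ι : Type*} [Fintype ι] [DecidableEq ι] (M : Matrix ι ι ℝ) : ℝ :=
  sSup (spectrum ℝ M)

/-! ### Numerical range, stability, Cholesky factor -/

/-- The numerical range `{xᴴ M x : x ∈ ℂⁿ, ‖x‖₂ = 1}` of a real matrix. -/
def numericalRange {n : ℕ} (M : Matrix (Fin n) (Fin n) ℝ) : Set ℂ :=
  {z | ∃ x : EuclideanSpace ℂ (Fin n), ‖x‖ = 1 ∧
    z = star x.ofLp ⬝ᵥ (M.map Complex.ofReal *ᵥ x.ofLp)}

/-- All complex eigenvalues of the real matrix `M` lie in the open left half-plane. -/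
def IsStable {n : ℕ} (M : Matrix (Fin n) (Fin n) ℝ) : Prop :=
  ∀ μ ∈ spectrum ℂ (M.map Complex.ofReal), μ.re < 0

/-- All complex eigenvalues of the real matrix `M` have nonpositive real part. -/
def IsWeaklyStable {n : ℕ} (M : Matrix (Fin n) (Fin n) ℝ) : Prop :=
  ∀ μ ∈ spectrum ℂ (M.map Complex.ofReal), μ.re ≤ 0

/-- `L` is the Cholesky factor of `F`: lower triangular with positive diagonal, `F = L Lᵀ`. -/
structure IsCholeskyFactor {n : ℕ} (F L : Matrix (Fin n) (Fin n) ℝ) : Prop where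
  lower : ∀ i j, i < j → L i j = 0
  diag_pos : ∀ i, 0 < L i i
  eq : F = L * Lᵀ

/-! ### The Riccati operator and the Lyapunov systems -/

/-- `R(X) = Aᵀ X + X A - X F X + Q`. -/
def residual {n : ℕ} (A F Q X : Matrix (Fin n) (Fin n) ℝ) : Matrix (Fin n) (Fin n) ℝ :=
  Aᵀ * X + X * A - X * F * X + Q

/-- The matrix of `X ↦ Mᵀ X + X M` with respect to the column-stacking `vec`,
that is `I ⊗ Mᵀ + Mᵀ ⊗ I`. -/
def lyapMatrix {n : ℕ} (M : Matrix (Fin n) (Fin n) ℝ) :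
    Matrix (Fin n × Fin n) (Fin n × Fin n) ℝ :=
  (1 : Matrix (Fin n) (Fin n) ℝ) ⊗ₖ Mᵀ + Mᵀ ⊗ₖ (1 : Matrix (Fin n) (Fin n) ℝ)

/-- The scaled Lyapunov matrix `(Lᵀ ⊗ Lᵀ) (I ⊗ Mᵀ + Mᵀ ⊗ I) (L⁻ᵀ ⊗ L⁻ᵀ)`. -/
def scaledLyapMatrix {n : ℕ} (L M : Matrix (Fin n) (Fin n) ℝ) :
    Matrix (Fin n × Fin n) (Fin n × Fin n) ℝ :=
  (Lᵀ ⊗ₖ Lᵀ) * lyapMatrix M * ((L⁻¹)ᵀ ⊗ₖ (L⁻¹)ᵀ)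

/-! ### GMRES with zero initial guess -/

/-- The Krylov space `span {b, M b, …, M ^ (m - 1) b}`. -/
def krylov {ι : Type*} [Fintype ι] [DecidableEq ι] (M : Matrix ι ι ℝ) (b : ι → ℝ) (m : ℕ) :
    Submodule ℝ (ι → ℝ) :=
  Submodule.span ℝ {v | ∃ j < m, v = (M ^ j) *ᵥ b}

/-- `x` is the result of `m` steps of GMRES (in exact arithmetic) for `M x = b`, started at `0`:
it minimizes the Euclidean norm of the residual over the `m`-th Krylov space. -/
def IsGMRESIterate {ι : Type*} [Fintype ι] [DecidableEq ι] (M : Matrix ι ι ℝ) (b : ι → ℝ)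
    (m : ℕ) (x : ι → ℝ) : Prop :=
  x ∈ krylov M b m ∧ ∀ y ∈ krylov M b m, vecNorm (b - M *ᵥ x) ≤ vecNorm (b - M *ᵥ y)

/-! ### The inexact Newton-Kleinman iteration -/

/-- A run of the inexact Newton-Kleinman iteration with line search (parameter `α`) and without
truncation. `X k` is the `k`-th iterate, `Xhat (k + 1)` the matrix returned by `it k` steps of
GMRES on the Lyapunov equation
`(A - F X_k)ᵀ Z + Z (A - F X_k) = - X_k F X_k - Q`, and `lam k` the step length. -/
structure IsNewtonKleinmanRun {n : ℕ} (A F Q : Matrix (Fin n) (Fin n) ℝ) (α : ℝ)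
    (X Xhat : ℕ → Matrix (Fin n) (Fin n) ℝ) (lam : ℕ → ℝ) (it : ℕ → ℕ) : Prop where
  gmres : ∀ k, IsGMRESIterate (lyapMatrix (A - F * X k))
    (-Matrix.vec (X k * F * X k + Q)) (it k) (Matrix.vec (Xhat (k + 1)))
  step_mem : ∀ k, 0 < lam k ∧ lam k ≤ 1
  line_search : ∀ k,
    specNorm (residual A F Q ((1 - lam k) • X k + lam k • Xhat (k + 1))) ≤
      (1 - lam k * α) * specNorm (residual A F Q (X k))
  update : ∀ k, X (k + 1) = (1 - lam k) • X k + lam k • Xhat (k + 1)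

/-- The lower bound required of the number of GMRES steps at an iterate `X`. With `S` the scaled
Lyapunov matrix at `X`, it is
`2 log ((1 + √2) κ(F) ‖X F X + Q‖_F / λ_min(Q)) / (- log (1 - μ² / λ_max(S Sᵀ)))`,
where `μ` is the smallest eigenvalue of the positive definite matrix `-(S + Sᵀ) / 2`.
If `μ² = λ_max(S Sᵀ)`, the quotient is `0`, the value it has with `- log 0 = ∞`. -/
def gmresBound {n : ℕ} (A F Q L X : Matrix (Fin n) (Fin n) ℝ) : ℝ :=
  let S := scaledLyapMatrix L (A - F * X)
  2 * Real.log ((1 + Real.sqrt 2) * (condNumber F * frobNorm (X * F * X + Q) / lambdaMin Q)) /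
    (-Real.log (1 - lambdaMin (-((1 / 2 : ℝ) • (S + Sᵀ))) ^ 2 / lambdaMax (S * Sᵀ)))

end

end Riccati

/-! In the Cholesky coordinates of `F = L Lᵀ` the closed-loop matrix `A - F X` becomes
`L⁻¹ A L - Lᵀ X L`, whose quadratic form is negative definite for every `X ⪰ 0`. Elman's GMRES
bound therefore applies to the scaled Lyapunov systems, and the prescribed number of steps makes
the Lyapunov residual `E` of `X̂` at most `λ_min(Q)` in the Frobenius norm. Hence
`M = A - F X` satisfies `-(Mᵀ X̂ + X̂ M) = X F X + Q + E ⪰ 0`, so `X̂ ⪰ 0`, and the next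
iterate, a convex combination of `X` and `X̂`, is again positive semidefinite. The line search
bounds the Riccati residuals by a multiple of `exp (-α ∑ λ_k)`. Completing the square in
`Lᵀ X - L⁻¹ A` bounds `X` by its residual, so the iterates eventually stay in a compact set. Each
cluster point is a positive semidefinite, hence stabilizing, solution of the Riccati equation, and
such a solution is unique because the difference of two solutions solves a nonsingular Sylvester
equation. -/

namespace Riccati

/-! ### Euclidean norm and Rayleigh quotients -/

section Rayleigh

variable {ι : Type*} [Fintype ι]

theorem vecNorm_eq_norm_toLp (v : ι → ℝ) : vecNorm v = ‖WithLp.toLp 2 v‖ := by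
  simp [vecNorm, EuclideanSpace.norm_eq]

theorem vecNorm_nonneg (v : ι → ℝ) : 0 ≤ vecNorm v :=
  Real.sqrt_nonneg _

theorem vecNorm_pos {v : ι → ℝ} (hv : v ≠ 0) : 0 < vecNorm v := by
  simpa [vecNorm_eq_norm_toLp] using hv

theorem vecNorm_sq (v : ι → ℝ) : vecNorm v ^ 2 = v ⬝ᵥ v := by
  rw [vecNorm, Real.sq_sqrt (Finset.sum_nonneg fun _ _ => sq_nonneg _)]
  simp only [dotProduct, pow_two]

theorem abs_dotProduct_le (v w : ι → ℝ) : |v ⬝ᵥ w| ≤ vecNorm v * vecNorm w := by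
  rw [vecNorm_eq_norm_toLp, vecNorm_eq_norm_toLp]
  simpa [EuclideanSpace.inner_eq_star_dotProduct, dotProduct_comm] using
    abs_real_inner_le_norm (WithLp.toLp 2 v) (WithLp.toLp 2 w)

variable [DecidableEq ι]

open scoped MatrixOrder in
theorem lambdaMin_mul_vecNorm_sq_le {M : Matrix ι ι ℝ} (hM : M.IsHermitian) (v : ι → ℝ) :
    lambdaMin M * vecNorm v ^ 2 ≤ v ⬝ᵥ M *ᵥ v := by
  have hle : algebraMap ℝ (Matrix ι ι ℝ) (lambdaMin M) ≤ M :=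
    (algebraMap_le_iff_le_spectrum (ha := hM)).2 fun _ hx =>
      csInf_le (Matrix.finite_spectrum M).bddBelow hx
  simpa [vecNorm_sq, Algebra.algebraMap_eq_smul_one, Matrix.sub_mulVec, Matrix.smul_mulVec] using
    (Matrix.le_iff.1 hle).dotProduct_mulVec_nonneg v

open scoped MatrixOrder in
theorem dotProduct_mulVec_le_lambdaMax_mul {M : Matrix ι ι ℝ} (hM : M.IsHermitian) (v : ι → ℝ) :
    v ⬝ᵥ M *ᵥ v ≤ lambdaMax M * vecNorm v ^ 2 := by
  have hle : M ≤ algebraMap ℝ (Matrix ι ι ℝ) (lambdaMax M) :=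
    (le_algebraMap_iff_spectrum_le (ha := hM)).2 fun _ hx =>
      le_csSup (Matrix.finite_spectrum M).bddAbove hx
  simpa [vecNorm_sq, Algebra.algebraMap_eq_smul_one, Matrix.sub_mulVec, Matrix.smul_mulVec] using
    (Matrix.le_iff.1 hle).dotProduct_mulVec_nonneg v

theorem lambdaMin_pos [Nonempty ι] {M : Matrix ι ι ℝ} (hM : M.PosDef) : 0 < lambdaMin M := by
  have hmem : lambdaMin M ∈ spectrum ℝ M := by
    refine Set.Nonempty.csInf_mem ?_ (Matrix.finite_spectrum M)
    rw [hM.isHermitian.spectrum_real_eq_range_eigenvalues]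
    exact Set.range_nonempty _
  rw [hM.isHermitian.spectrum_real_eq_range_eigenvalues] at hmem
  obtain ⟨i, hi⟩ := hmem
  exact hi ▸ hM.eigenvalues_pos i

theorem lambdaMax_mul_comm (M N : Matrix ι ι ℝ) : lambdaMax (M * N) = lambdaMax (N * M) := by
  have h : spectrum ℝ (M * N) = spectrum ℝ (N * M) := by
    ext r
    rw [Matrix.mem_spectrum_iff_isRoot_charpoly, Matrix.charpoly_mul_comm,
      ← Matrix.mem_spectrum_iff_isRoot_charpoly]
  rw [lambdaMax, h, lambdaMax]

theorem vecNorm_mulVec_sq_le (S : Matrix ι ι ℝ) (v : ι → ℝ) :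
    vecNorm (S *ᵥ v) ^ 2 ≤ lambdaMax (S * Sᵀ) * vecNorm v ^ 2 := by
  have hH : (Sᵀ * S).IsHermitian := Matrix.isHermitian_conjTranspose_mul_self S
  calc vecNorm (S *ᵥ v) ^ 2 = v ⬝ᵥ (Sᵀ * S) *ᵥ v := by
        rw [vecNorm_sq, ← Matrix.mulVec_mulVec, Matrix.dotProduct_transpose_mulVec]
    _ ≤ lambdaMax (S * Sᵀ) * vecNorm v ^ 2 := by
        rw [lambdaMax_mul_comm]
        exact dotProduct_mulVec_le_lambdaMax_mul hH v

end Rayleigh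

/-! ### Strictly dissipative matrices -/

section Dissipative

variable {ι : Type*}

/-- The negative `-(N + Nᵀ) / 2` of the symmetric part of `N`; the sign makes it positive definite
for strictly dissipative `N`. -/
noncomputable def negSymmPart (N : Matrix ι ι ℝ) : Matrix ι ι ℝ :=
  -((1 / 2 : ℝ) • (N + Nᵀ))

theorem isHermitian_negSymmPart (N : Matrix ι ι ℝ) : (negSymmPart N).IsHermitian := by
  rw [Matrix.isHermitian_iff_isSymm]
  simp [negSymmPart, Matrix.IsSymm, add_comm]

variable [Fintype ι]

/-- Strict dissipativity of a real matrix: its quadratic form is negative definite. The matrix is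
not assumed to be symmetric. -/
def IsStrictlyDissipative (N : Matrix ι ι ℝ) : Prop :=
  ∀ v : ι → ℝ, v ≠ 0 → v ⬝ᵥ N *ᵥ v < 0

theorem dotProduct_negSymmPart_mulVec (N : Matrix ι ι ℝ) (v : ι → ℝ) :
    v ⬝ᵥ negSymmPart N *ᵥ v = -(v ⬝ᵥ N *ᵥ v) := by
  rw [negSymmPart, Matrix.neg_mulVec, Matrix.smul_mulVec, Matrix.add_mulVec, dotProduct_neg,
    dotProduct_smul, dotProduct_add, Matrix.dotProduct_transpose_mulVec, smul_eq_mul]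
  ring

theorem posDef_negSymmPart_iff {N : Matrix ι ι ℝ} :
    (negSymmPart N).PosDef ↔ IsStrictlyDissipative N := by
  simp only [Matrix.posDef_iff_dotProduct_mulVec, isHermitian_negSymmPart, true_and, star_trivial,
    dotProduct_negSymmPart_mulVec, neg_pos, IsStrictlyDissipative]

theorem IsStrictlyDissipative.dotProduct_mulVec_nonpos {N : Matrix ι ι ℝ}
    (hN : IsStrictlyDissipative N) (v : ι → ℝ) : v ⬝ᵥ N *ᵥ v ≤ 0 := by
  rcases eq_or_ne v 0 with rfl | hv
  · simp
  · exact (hN v hv).le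

variable [DecidableEq ι]

/-- The best constant `μ` such that `⟨v, S v⟩ ≤ -μ ‖v‖²` for all `v`. -/
noncomputable def coercivityConst (S : Matrix ι ι ℝ) : ℝ :=
  lambdaMin (negSymmPart S)

theorem dotProduct_mulVec_le_neg_coercivityConst (S : Matrix ι ι ℝ) (v : ι → ℝ) :
    v ⬝ᵥ S *ᵥ v ≤ -(coercivityConst S * vecNorm v ^ 2) := by
  have h := lambdaMin_mul_vecNorm_sq_le (isHermitian_negSymmPart S) v
  rw [dotProduct_negSymmPart_mulVec] at h
  exact le_neg_of_le_neg h

theorem IsStrictlyDissipative.coercivityConst_pos [Nonempty ι] {S : Matrix ι ι ℝ}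
    (hS : IsStrictlyDissipative S) : 0 < coercivityConst S :=
  lambdaMin_pos (posDef_negSymmPart_iff.2 hS)

end Dissipative

/-! ### The residual bound for GMRES -/

section GMRES

open Polynomial

variable {ι : Type*} [Fintype ι] [DecidableEq ι]

theorem aeval_mulVec_mem_krylov (M : Matrix ι ι ℝ) (b : ι → ℝ) {q : ℝ[X]} {m : ℕ}
    (hq : q.degree < m) : aeval M q *ᵥ b ∈ krylov M b m := by
  rw [aeval_eq_sum_range, Matrix.sum_mulVec]
  refine Submodule.sum_mem _ fun j _ => ?_
  rw [Matrix.smul_mulVec]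
  by_cases hj : q.coeff j = 0
  · simp [hj]
  · refine Submodule.smul_mem _ _ (Submodule.subset_span ⟨j, ?_, rfl⟩)
    exact_mod_cast (le_degree_of_ne_zero hj).trans_lt hq

theorem IsGMRESIterate.vecNorm_residual_le_aeval {M : Matrix ι ι ℝ} {b x : ι → ℝ} {m : ℕ}
    (h : IsGMRESIterate M b m x) {p : ℝ[X]} (hp : p.coeff 0 = 1) (hdeg : p.degree ≤ m) :
    vecNorm (b - M *ᵥ x) ≤ vecNorm (aeval M p *ᵥ b) := by
  have hp0 : p ≠ 0 := by
    rintro rfl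
    simp at hp
  have hmem := aeval_mulVec_mem_krylov M b ((degree_divX_lt hp0).trans_le hdeg)
  have heq : aeval M p *ᵥ b = b - M *ᵥ (-(aeval M p.divX *ᵥ b)) := by
    conv_lhs => rw [← divX_mul_X_add p, hp]
    rw [mul_comm, map_add, map_mul, aeval_X, map_one, map_one, Matrix.add_mulVec,
      Matrix.one_mulVec, ← Matrix.mulVec_mulVec, Matrix.mulVec_neg, sub_neg_eq_add, add_comm]
  rw [heq]
  exact h.2 _ (neg_mem hmem)

/-- The square of the contraction factor per step in Elman's bound for the GMRES residual. -/
noncomputable def elmanFactor (S : Matrix ι ι ℝ) : ℝ :=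
  1 - coercivityConst S ^ 2 / lambdaMax (S * Sᵀ)

theorem IsStrictlyDissipative.lambdaMax_pos [Nonempty ι] {S : Matrix ι ι ℝ}
    (hS : IsStrictlyDissipative S) : 0 < lambdaMax (S * Sᵀ) := by
  obtain ⟨v, hv⟩ := exists_ne (0 : ι → ℝ)
  have hSv : S *ᵥ v ≠ 0 := by
    intro h0
    simpa [h0] using hS v hv
  exact pos_of_mul_pos_left ((pow_pos (vecNorm_pos hSv) 2).trans_le (vecNorm_mulVec_sq_le S v))
    (sq_nonneg _)

theorem IsStrictlyDissipative.elmanFactor_lt_one [Nonempty ι] {S : Matrix ι ι ℝ}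
    (hS : IsStrictlyDissipative S) : elmanFactor S < 1 :=
  sub_lt_self 1 (div_pos (pow_pos hS.coercivityConst_pos 2) hS.lambdaMax_pos)

theorem vecNorm_one_add_smul_mulVec_sq_le (S : Matrix ι ι ℝ) {ω : ℝ} (hω : 0 ≤ ω) (v : ι → ℝ) :
    vecNorm ((1 + ω • S) *ᵥ v) ^ 2 ≤
      (1 - 2 * ω * coercivityConst S + ω ^ 2 * lambdaMax (S * Sᵀ)) * vecNorm v ^ 2 :=
  calc vecNorm ((1 + ω • S) *ᵥ v) ^ 2
      = vecNorm v ^ 2 + 2 * ω * (v ⬝ᵥ S *ᵥ v) + ω ^ 2 * vecNorm (S *ᵥ v) ^ 2 := by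
        simp only [vecNorm_sq, Matrix.add_mulVec, Matrix.one_mulVec, Matrix.smul_mulVec,
          add_dotProduct, dotProduct_add, smul_dotProduct, dotProduct_smul, smul_eq_mul,
          dotProduct_comm (S *ᵥ v) v]
        ring
    _ ≤ vecNorm v ^ 2 + 2 * ω * -(coercivityConst S * vecNorm v ^ 2) +
          ω ^ 2 * (lambdaMax (S * Sᵀ) * vecNorm v ^ 2) := by
        gcongr
        · exact dotProduct_mulVec_le_neg_coercivityConst S v
        · exact vecNorm_mulVec_sq_le S v
    _ = _ := by ring

theorem IsStrictlyDissipative.exists_vecNorm_one_add_smul_pow_le [Nonempty ι] {S : Matrix ι ι ℝ}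
    (hS : IsStrictlyDissipative S) : ∃ ω : ℝ, ∀ (m : ℕ) (v : ι → ℝ),
      vecNorm ((1 + ω • S) ^ m *ᵥ v) ≤ √(elmanFactor S) ^ m * vecNorm v := by
  have hμ := hS.coercivityConst_pos
  have hΛ := hS.lambdaMax_pos
  -- This `ω` minimizes the quadratic `1 - 2 ω μ + ω² Λ`.
  set ω := coercivityConst S / lambdaMax (S * Sᵀ)
  have hfactor : 1 - 2 * ω * coercivityConst S + ω ^ 2 * lambdaMax (S * Sᵀ) = elmanFactor S := by
    simp only [elmanFactor, ω]
    field_simp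
    ring
  have hstep (v : ι → ℝ) : vecNorm ((1 + ω • S) *ᵥ v) ≤ √(elmanFactor S) * vecNorm v := by
    have h := vecNorm_one_add_smul_mulVec_sq_le S (div_pos hμ hΛ).le v
    rw [hfactor] at h
    calc vecNorm ((1 + ω • S) *ᵥ v) ≤ √(elmanFactor S * vecNorm v ^ 2) := Real.le_sqrt_of_sq_le h
      _ = √(elmanFactor S) * vecNorm v := by
        rw [Real.sqrt_mul' _ (sq_nonneg _), Real.sqrt_sq (vecNorm_nonneg v)]
  refine ⟨ω, fun m v => ?_⟩
  induction m with
  | zero => simp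
  | succ m ih =>
    calc vecNorm ((1 + ω • S) ^ (m + 1) *ᵥ v)
        = vecNorm ((1 + ω • S) *ᵥ ((1 + ω • S) ^ m *ᵥ v)) := by
          rw [pow_succ', Matrix.mulVec_mulVec]
      _ ≤ √(elmanFactor S) * (√(elmanFactor S) ^ m * vecNorm v) :=
          (hstep _).trans (mul_le_mul_of_nonneg_left ih (Real.sqrt_nonneg _))
      _ = √(elmanFactor S) ^ (m + 1) * vecNorm v := by ring

theorem IsGMRESIterate.vecNorm_residual_le_of_similar [Nonempty ι] {T M S : Matrix ι ι ℝ}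
    {b x : ι → ℝ} {m : ℕ} (h : IsGMRESIterate M b m x) (hTM : T * M = S * T)
    (hS : IsStrictlyDissipative S) {c d : ℝ} (hd : 0 ≤ d)
    (hT : ∀ v, vecNorm (T *ᵥ v) ≤ c * vecNorm v) (hT' : ∀ v, vecNorm v ≤ d * vecNorm (T *ᵥ v)) :
    vecNorm (b - M *ᵥ x) ≤ d * c * √(elmanFactor S) ^ m * vecNorm b := by
  obtain ⟨ω, hω⟩ := hS.exists_vecNorm_one_add_smul_pow_le
  have hpoly : vecNorm (b - M *ᵥ x) ≤ vecNorm ((1 + ω • M) ^ m *ᵥ b) := by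
    have hdeg : ((1 + C ω * X : ℝ[X]) ^ m).degree ≤ m := by
      refine degree_le_of_natDegree_le ?_
      compute_degree
    simpa [← Algebra.smul_def] using h.vecNorm_residual_le_aeval (p := (1 + C ω * X) ^ m)
      (by simp [coeff_zero_eq_eval_zero]) hdeg
  have hpow : T * (1 + ω • M) ^ m = (1 + ω • S) ^ m * T :=
    (SemiconjBy.pow_right (show SemiconjBy T (1 + ω • M) (1 + ω • S) by
      simp [SemiconjBy, mul_add, add_mul, hTM]) m).eq
  calc vecNorm (b - M *ᵥ x) ≤ d * vecNorm ((1 + ω • S) ^ m *ᵥ (T *ᵥ b)) := by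
        rw [Matrix.mulVec_mulVec, ← hpow, ← Matrix.mulVec_mulVec]
        exact hpoly.trans (hT' _)
    _ ≤ d * (√(elmanFactor S) ^ m * (c * vecNorm b)) := by
        gcongr
        exact (hω m _).trans (mul_le_mul_of_nonneg_left (hT b) (by positivity))
    _ = d * c * √(elmanFactor S) ^ m * vecNorm b := by ring

end GMRES

/-! ### Spectral and Frobenius norms -/

section Norms

variable {n : ℕ}

theorem specNorm_nonneg (M : Matrix (Fin n) (Fin n) ℝ) : 0 ≤ specNorm M :=
  norm_nonneg _

theorem vecNorm_mulVec_le_specNorm_mul (M : Matrix (Fin n) (Fin n) ℝ) (v : Fin n → ℝ) :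
    vecNorm (M *ᵥ v) ≤ specNorm M * vecNorm v := by
  rw [vecNorm_eq_norm_toLp, vecNorm_eq_norm_toLp]
  exact (Matrix.toEuclideanCLM (n := Fin n) (𝕜 := ℝ) M).le_opNorm (WithLp.toLp 2 v)

open scoped Matrix.Norms.L2Operator in
theorem specNorm_transpose_mul_self (K : Matrix (Fin n) (Fin n) ℝ) :
    specNorm (Kᵀ * K) = specNorm K ^ 2 :=
  (Matrix.l2_opNorm_conjTranspose_mul_self K).trans (sq _).symm

open scoped Matrix.Norms.L2Operator in
theorem specNorm_transpose (K : Matrix (Fin n) (Fin n) ℝ) : specNorm Kᵀ = specNorm K :=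
  Matrix.l2_opNorm_conjTranspose K

theorem specNorm_mul_transpose_self (K : Matrix (Fin n) (Fin n) ℝ) :
    specNorm (K * Kᵀ) = specNorm K ^ 2 := by
  rw [← specNorm_transpose K, ← specNorm_transpose_mul_self, Matrix.transpose_transpose]

theorem condNumber_mul_transpose_self (L : Matrix (Fin n) (Fin n) ℝ) :
    condNumber (L * Lᵀ) = specNorm L⁻¹ ^ 2 * specNorm L ^ 2 := by
  rw [condNumber, specNorm_mul_transpose_self, Matrix.mul_inv_rev, ← Matrix.transpose_nonsing_inv,
    specNorm_transpose_mul_self, mul_comm]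

theorem frobNorm_nonneg (M : Matrix (Fin n) (Fin n) ℝ) : 0 ≤ frobNorm M :=
  Real.sqrt_nonneg _

theorem frobNorm_transpose (M : Matrix (Fin n) (Fin n) ℝ) : frobNorm Mᵀ = frobNorm M := by
  rw [frobNorm, frobNorm, Finset.sum_comm]
  simp only [Matrix.transpose_apply]

theorem frobNorm_neg (M : Matrix (Fin n) (Fin n) ℝ) : frobNorm (-M) = frobNorm M := by
  simp [frobNorm]

theorem vecNorm_vec (M : Matrix (Fin n) (Fin n) ℝ) : vecNorm (Matrix.vec M) = frobNorm M := by
  rw [frobNorm, Finset.sum_comm]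
  simp [vecNorm, Matrix.vec, Fintype.sum_prod_type]

theorem frobNorm_sq_eq_sum_col (M : Matrix (Fin n) (Fin n) ℝ) :
    frobNorm M ^ 2 = ∑ j, vecNorm (M.col j) ^ 2 := by
  rw [← vecNorm_vec, vecNorm_sq]
  simp [vecNorm_sq, dotProduct, Matrix.vec, Fintype.sum_prod_type]

theorem vecNorm_mulVec_le_frobNorm_mul (M : Matrix (Fin n) (Fin n) ℝ) (v : Fin n → ℝ) :
    vecNorm (M *ᵥ v) ≤ frobNorm M * vecNorm v := by
  rw [vecNorm, frobNorm, vecNorm, ← Real.sqrt_mul (by positivity), Finset.sum_mul]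
  exact Real.sqrt_le_sqrt <| Finset.sum_le_sum fun i _ =>
    Finset.sum_mul_sq_le_sq_mul_sq Finset.univ (M i) v

theorem frobNorm_mul_le (M N : Matrix (Fin n) (Fin n) ℝ) :
    frobNorm (M * N) ≤ specNorm M * frobNorm N := by
  refine le_of_sq_le_sq ?_ (mul_nonneg (specNorm_nonneg M) (frobNorm_nonneg N))
  rw [mul_pow, frobNorm_sq_eq_sum_col, frobNorm_sq_eq_sum_col, Finset.mul_sum]
  refine Finset.sum_le_sum fun j _ => ?_
  rw [← mul_pow]
  exact pow_le_pow_left₀ (vecNorm_nonneg _) (vecNorm_mulVec_le_specNorm_mul M (N.col j)) 2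

theorem frobNorm_transpose_mul_mul_le (K Z : Matrix (Fin n) (Fin n) ℝ) :
    frobNorm (Kᵀ * Z * K) ≤ specNorm K ^ 2 * frobNorm Z := by
  have h (Y : Matrix (Fin n) (Fin n) ℝ) : frobNorm (Kᵀ * Y) ≤ specNorm K * frobNorm Y :=
    specNorm_transpose K ▸ frobNorm_mul_le Kᵀ Y
  calc frobNorm (Kᵀ * Z * K) = frobNorm (Kᵀ * (Kᵀ * Z)ᵀ) := by
        rw [← frobNorm_transpose, Matrix.transpose_mul]
    _ ≤ specNorm K * (specNorm K * frobNorm Z) :=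
        (h _).trans <| mul_le_mul_of_nonneg_left ((frobNorm_transpose _).trans_le (h Z))
          (specNorm_nonneg K)
    _ = specNorm K ^ 2 * frobNorm Z := by ring

end Norms

/-! ### Lyapunov equations -/

section Lyapunov

theorem krylov_le_of_mulVec_mem {ι : Type*} [Fintype ι] [DecidableEq ι] {M : Matrix ι ι ℝ}
    {b : ι → ℝ} {W : Submodule ℝ (ι → ℝ)} (hb : b ∈ W) (hM : ∀ v ∈ W, M *ᵥ v ∈ W) (m : ℕ) :
    krylov M b m ≤ W := by
  refine Submodule.span_le.2 ?_
  rintro _ ⟨j, -, rfl⟩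
  induction j with
  | zero => simpa using hb
  | succ j ih =>
    rw [pow_succ', ← Matrix.mulVec_mulVec]
    exact hM _ ih

theorem IsStrictlyDissipative.posSemidef_of_lyapunov {ι : Type*} [Fintype ι]
    {N Y : Matrix ι ι ℝ} (hN : IsStrictlyDissipative N) (hY : Y.IsHermitian)
    (h : (-(Nᵀ * Y + Y * N)).PosSemidef) : Y.PosSemidef := by
  classical
  rw [hY.posSemidef_iff_eigenvalues_nonneg]
  intro i
  set u : ι → ℝ := (hY.eigenvectorBasis i).ofLp
  have hu : u ≠ 0 := by
    simpa [u] using hY.eigenvectorBasis.orthonormal.ne_zero i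
  have hYu : Y *ᵥ u = hY.eigenvalues i • u := hY.mulVec_eigenvectorBasis i
  have hYT : Yᵀ = Y := Matrix.isHermitian_iff_isSymm.1 hY
  have hform : u ⬝ᵥ (Nᵀ * Y + Y * N) *ᵥ u = 2 * hY.eigenvalues i * (u ⬝ᵥ N *ᵥ u) := by
    have h1 : u ⬝ᵥ Nᵀ *ᵥ Y *ᵥ u = hY.eigenvalues i * (u ⬝ᵥ N *ᵥ u) := by
      rw [hYu, Matrix.dotProduct_transpose_mulVec, smul_dotProduct, smul_eq_mul]
    have h2 : u ⬝ᵥ Y *ᵥ N *ᵥ u = u ⬝ᵥ Nᵀ *ᵥ Y *ᵥ u := by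
      rw [Matrix.dotProduct_transpose_mulVec, ← hYT, Matrix.dotProduct_transpose_mulVec, hYT,
        dotProduct_comm]
    rw [Matrix.add_mulVec, dotProduct_add, ← Matrix.mulVec_mulVec, ← Matrix.mulVec_mulVec, h2, h1]
    ring
  have hnonneg := h.dotProduct_mulVec_nonneg u
  rw [star_trivial, Matrix.neg_mulVec, dotProduct_neg, hform] at hnonneg
  have hneg := hN u hu
  simp only [Pi.zero_apply]
  nlinarith

theorem posSemidef_of_lyapunov_of_similar {ι : Type*} [Fintype ι] [DecidableEq ι]
    {L M Z : Matrix ι ι ℝ} (hL : IsUnit L.det) (hM : IsStrictlyDissipative (L⁻¹ * M * L))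
    (hZ : Z.IsHermitian) (h : (-(Mᵀ * Z + Z * M)).PosSemidef) : Z.PosSemidef := by
  set N := L⁻¹ * M * L
  have hML : M * L = L * N := by
    rw [show N = L⁻¹ * (M * L) from mul_assoc _ _ _, Matrix.mul_nonsing_inv_cancel_left _ _ hL]
  have hMLT : Lᵀ * Mᵀ = Nᵀ * Lᵀ := by
    rw [← Matrix.transpose_mul, hML, Matrix.transpose_mul]
  have hcongr : -(Nᵀ * (Lᵀ * Z * L) + Lᵀ * Z * L * N) = Lᵀ * -(Mᵀ * Z + Z * M) * L := by
    calc _ = -(Nᵀ * Lᵀ * Z * L + Lᵀ * Z * (L * N)) := by simp only [mul_assoc]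
      _ = _ := by rw [← hMLT, ← hML]; noncomm_ring
  rw [← Matrix.IsUnit.posSemidef_star_left_conjugate_iff ((Matrix.isUnit_iff_isUnit_det L).2 hL)]
  refine hM.posSemidef_of_lyapunov (Matrix.isHermitian_conjTranspose_mul_mul L hZ) ?_
  exact hcongr ▸ h.conjTranspose_mul_mul_same L

variable {n : ℕ}

theorem lyapMatrix_mulVec_vec (M Z : Matrix (Fin n) (Fin n) ℝ) :
    lyapMatrix M *ᵥ Matrix.vec Z = Matrix.vec (Mᵀ * Z + Z * M) := by
  rw [lyapMatrix, Matrix.add_mulVec, Matrix.kronecker_mulVec_vec, Matrix.kronecker_mulVec_vec]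
  simp

theorem IsGMRESIterate.isSymm_of_lyapMatrix {M B Z : Matrix (Fin n) (Fin n) ℝ} {m : ℕ}
    (h : IsGMRESIterate (lyapMatrix M) (Matrix.vec B) m (Matrix.vec Z)) (hB : B.IsSymm) :
    Z.IsSymm := by
  let W : Submodule ℝ (Fin n × Fin n → ℝ) :=
    LinearMap.eqLocus (LinearMap.funLeft ℝ ℝ Prod.swap) LinearMap.id
  have hW (P : Matrix (Fin n) (Fin n) ℝ) : Matrix.vec P ∈ W ↔ P.IsSymm := by
    rw [Matrix.IsSymm, ← Matrix.vec_inj, Matrix.vec_transpose]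
    rfl
  refine (hW Z).1 (krylov_le_of_mulVec_mem ((hW B).2 hB) (fun v hv => ?_) m h.1)
  obtain ⟨P, rfl⟩ := Matrix.vec_bijective.surjective v
  rw [lyapMatrix_mulVec_vec, hW]
  simp [Matrix.IsSymm, ((hW P).1 hv).eq, add_comm]

theorem negSymmPart_lyapMatrix (N : Matrix (Fin n) (Fin n) ℝ) :
    negSymmPart (lyapMatrix N) = 1 ⊗ₖ negSymmPart N + negSymmPart N ⊗ₖ 1 := by
  simp only [negSymmPart, lyapMatrix, ← neg_smul, Matrix.transpose_add,
    ← Matrix.kroneckerMap_transpose, Matrix.transpose_one, Matrix.transpose_transpose,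
    Matrix.kronecker_smul, Matrix.smul_kronecker, Matrix.kronecker_add, Matrix.add_kronecker]
  module

theorem IsStrictlyDissipative.lyapMatrix {N : Matrix (Fin n) (Fin n) ℝ}
    (hN : IsStrictlyDissipative N) : IsStrictlyDissipative (lyapMatrix N) := by
  have hH := posDef_negSymmPart_iff.2 hN
  rw [← posDef_negSymmPart_iff, negSymmPart_lyapMatrix]
  exact (Matrix.PosDef.one.kronecker hH).add (hH.kronecker .one)

theorem scaledLyapMatrix_eq_lyapMatrix {L : Matrix (Fin n) (Fin n) ℝ} (hL : IsUnit L.det)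
    (M : Matrix (Fin n) (Fin n) ℝ) : scaledLyapMatrix L M = lyapMatrix (L⁻¹ * M * L) := by
  have h : Lᵀ * (L⁻¹)ᵀ = 1 := by
    rw [← Matrix.transpose_mul, Matrix.nonsing_inv_mul _ hL, Matrix.transpose_one]
  simp only [scaledLyapMatrix, lyapMatrix, mul_add, add_mul, ← Matrix.mul_kronecker_mul,
    Matrix.transpose_mul, mul_one, h, mul_assoc]

theorem IsStrictlyDissipative.scaledLyapMatrix {L M : Matrix (Fin n) (Fin n) ℝ}
    (hM : IsStrictlyDissipative (L⁻¹ * M * L)) (hL : IsUnit L.det) :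
    IsStrictlyDissipative (scaledLyapMatrix L M) := by
  rw [scaledLyapMatrix_eq_lyapMatrix hL]
  exact hM.lyapMatrix

theorem kronecker_mul_lyapMatrix {L : Matrix (Fin n) (Fin n) ℝ} (hL : IsUnit L.det)
    (M : Matrix (Fin n) (Fin n) ℝ) :
    (Lᵀ ⊗ₖ Lᵀ) * lyapMatrix M = scaledLyapMatrix L M * (Lᵀ ⊗ₖ Lᵀ) := by
  have h : (L⁻¹)ᵀ * Lᵀ = 1 := by
    rw [← Matrix.transpose_mul, Matrix.mul_nonsing_inv _ hL, Matrix.transpose_one]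
  rw [scaledLyapMatrix, mul_assoc _ _ (Lᵀ ⊗ₖ Lᵀ), ← Matrix.mul_kronecker_mul, h,
    Matrix.one_kronecker_one, mul_one]

theorem IsGMRESIterate.frobNorm_lyapunov_residual_le [Nonempty (Fin n)]
    {L M B Z : Matrix (Fin n) (Fin n) ℝ} {m : ℕ}
    (h : IsGMRESIterate (lyapMatrix M) (Matrix.vec B) m (Matrix.vec Z)) (hL : IsUnit L.det)
    (hM : IsStrictlyDissipative (L⁻¹ * M * L)) :
    frobNorm (B - (Mᵀ * Z + Z * M)) ≤
      condNumber (L * Lᵀ) * √(elmanFactor (scaledLyapMatrix L M)) ^ m * frobNorm B := by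
  have hT (W : Matrix (Fin n) (Fin n) ℝ) :
      (Lᵀ ⊗ₖ Lᵀ) *ᵥ Matrix.vec W = Matrix.vec (Lᵀ * W * L) := by
    rw [Matrix.kronecker_mulVec_vec, Matrix.transpose_transpose]
  have hcancel (W : Matrix (Fin n) (Fin n) ℝ) : (L⁻¹)ᵀ * (Lᵀ * W * L) * L⁻¹ = W := by
    have hLT : IsUnit Lᵀ.det := by rwa [Matrix.det_transpose]
    rw [Matrix.transpose_nonsing_inv, mul_assoc Lᵀ, Matrix.nonsing_inv_mul_cancel_left _ _ hLT,
      Matrix.mul_nonsing_inv_cancel_right _ _ hL]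
  rw [condNumber_mul_transpose_self, ← vecNorm_vec, ← vecNorm_vec, Matrix.vec_sub,
    ← lyapMatrix_mulVec_vec]
  refine h.vecNorm_residual_le_of_similar (kronecker_mul_lyapMatrix hL M)
    (hM.scaledLyapMatrix hL) (sq_nonneg _) (fun v => ?_) fun v => ?_
  all_goals
    obtain ⟨W, rfl⟩ := Matrix.vec_bijective.surjective v
    rw [hT, vecNorm_vec, vecNorm_vec]
  · exact frobNorm_transpose_mul_mul_le L W
  · simpa only [hcancel] using frobNorm_transpose_mul_mul_le L⁻¹ (Lᵀ * W * L)

end Lyapunov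

/-! ### One step of the iteration -/

section Step

theorem mul_sqrt_pow_le_one {c ρ : ℝ} {m : ℕ} (hρ : ρ < 1) (h : m ≠ 0)
    (hm : 2 * Real.log c / (-Real.log ρ) ≤ m) : c * √ρ ^ m ≤ 1 := by
  rcases le_or_gt c 0 with hc | hc
  · exact (mul_nonpos_of_nonpos_of_nonneg hc (by positivity)).trans zero_le_one
  rcases le_or_gt ρ 0 with hρ0 | hρ0
  · rw [Real.sqrt_eq_zero_of_nonpos hρ0, zero_pow h, mul_zero]
    exact zero_le_one
  rw [div_le_iff₀ (neg_pos.2 (Real.log_neg hρ0 hρ))] at hm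
  rw [← Real.log_nonpos_iff (by positivity), Real.log_mul hc.ne' (by positivity), Real.log_pow,
    Real.log_sqrt hρ0.le]
  linarith

variable {n : ℕ}

theorem IsGMRESIterate.frobNorm_lyapunov_residual_le_of_log_le [Nonempty (Fin n)]
    {L M B Z : Matrix (Fin n) (Fin n) ℝ} {m : ℕ} {c δ : ℝ}
    (h : IsGMRESIterate (lyapMatrix M) (Matrix.vec B) m (Matrix.vec Z)) (hL : IsUnit L.det)
    (hM : IsStrictlyDissipative (L⁻¹ * M * L)) (hδ : 0 ≤ δ) (hm0 : m ≠ 0)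
    (hc : condNumber (L * Lᵀ) * frobNorm B ≤ c * δ)
    (hm : 2 * Real.log c / (-Real.log (elmanFactor (scaledLyapMatrix L M))) ≤ m) :
    frobNorm (B - (Mᵀ * Z + Z * M)) ≤ δ := by
  set ρ := elmanFactor (scaledLyapMatrix L M)
  have hρ : ρ < 1 := (hM.scaledLyapMatrix hL).elmanFactor_lt_one
  calc frobNorm (B - (Mᵀ * Z + Z * M)) ≤ condNumber (L * Lᵀ) * √ρ ^ m * frobNorm B :=
        h.frobNorm_lyapunov_residual_le hL hM
    _ = condNumber (L * Lᵀ) * frobNorm B * √ρ ^ m := by ring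
    _ ≤ c * δ * √ρ ^ m := by gcongr
    _ = c * √ρ ^ m * δ := by ring
    _ ≤ δ := mul_le_of_le_one_left hδ (mul_sqrt_pow_le_one hρ hm0 hm)

theorem posSemidef_add_of_frobNorm_le_lambdaMin {Q E : Matrix (Fin n) (Fin n) ℝ}
    (hQ : Q.IsHermitian) (hE : E.IsHermitian) (h : frobNorm E ≤ lambdaMin Q) :
    (Q + E).PosSemidef := by
  refine .of_dotProduct_mulVec_nonneg (hQ.add hE) fun v => ?_
  have hEv : |v ⬝ᵥ E *ᵥ v| ≤ lambdaMin Q * vecNorm v ^ 2 :=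
    calc |v ⬝ᵥ E *ᵥ v| ≤ vecNorm v * vecNorm (E *ᵥ v) := abs_dotProduct_le v _
      _ ≤ vecNorm v * (frobNorm E * vecNorm v) :=
          mul_le_mul_of_nonneg_left (vecNorm_mulVec_le_frobNorm_mul E v) (vecNorm_nonneg v)
      _ = frobNorm E * vecNorm v ^ 2 := by ring
      _ ≤ lambdaMin Q * vecNorm v ^ 2 := by gcongr
  rw [star_trivial, Matrix.add_mulVec, dotProduct_add]
  linarith [lambdaMin_mul_vecNorm_sq_le hQ v, (abs_le.1 hEv).1]

theorem isStrictlyDissipative_closedLoop {A L X : Matrix (Fin n) (Fin n) ℝ} (hL : IsUnit L.det)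
    (hA : IsStrictlyDissipative (L⁻¹ * A * L)) (hX : X.PosSemidef) :
    IsStrictlyDissipative (L⁻¹ * (A - L * Lᵀ * X) * L) := by
  have hconj : L⁻¹ * (A - L * Lᵀ * X) * L = L⁻¹ * A * L - Lᵀ * X * L := by
    rw [mul_sub, sub_mul, mul_assoc L, Matrix.nonsing_inv_mul_cancel_left _ _ hL]
  intro v hv
  have hX' : 0 ≤ v ⬝ᵥ (Lᵀ * X * L) *ᵥ v :=
    (hX.conjTranspose_mul_mul_same L).dotProduct_mulVec_nonneg v
  rw [hconj, Matrix.sub_mulVec, dotProduct_sub]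
  linarith [hA v hv]

theorem IsGMRESIterate.eq_zero_of_zero_steps {ι : Type*} [Fintype ι] [DecidableEq ι]
    {M : Matrix ι ι ℝ} {b x : ι → ℝ} (h : IsGMRESIterate M b 0 x) : x = 0 := by
  simpa [krylov] using h.1

theorem posSemidef_of_isGMRESIterate {A Q L X Z : Matrix (Fin n) (Fin n) ℝ} (hQ : Q.PosDef)
    (hL : IsUnit L.det) (hA : IsStrictlyDissipative (L⁻¹ * A * L)) (hX : X.PosSemidef) {m : ℕ}
    (hg : IsGMRESIterate (lyapMatrix (A - L * Lᵀ * X)) (-Matrix.vec (X * (L * Lᵀ) * X + Q)) m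
      (Matrix.vec Z))
    (hm : gmresBound A (L * Lᵀ) Q L X ≤ m) : Z.PosSemidef := by
  rcases isEmpty_or_nonempty (Fin n) with hn | hn
  · rw [Subsingleton.elim Z 0]
    exact .zero
  -- No GMRES step is required when `elmanFactor` vanishes, since then `gmresBound` is `0`.
  by_cases hm0 : m = 0
  · subst hm0
    rw [Matrix.vec_eq_zero_iff.1 hg.eq_zero_of_zero_steps]
    exact .zero
  have hM := isStrictlyDissipative_closedLoop hL hA hX
  set M := A - L * Lᵀ * X
  set P := X * (L * Lᵀ) * X
  have hP : P.PosSemidef := by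
    have h := (Matrix.posSemidef_self_mul_conjTranspose L).conjTranspose_mul_mul_same X
    rwa [hX.isHermitian.eq] at h
  have hPQ : (-(P + Q)).IsHermitian := (hP.isHermitian.add hQ.isHermitian).neg
  rw [← Matrix.vec_neg] at hg
  have hZ : Z.IsHermitian := Matrix.isHermitian_iff_isSymm.2
    (hg.isSymm_of_lyapMatrix (Matrix.isHermitian_iff_isSymm.1 hPQ))
  set E := -(P + Q) - (Mᵀ * Z + Z * M) with hE
  have hle : frobNorm E ≤ lambdaMin Q := by
    have hlQ := lambdaMin_pos hQ
    refine hg.frobNorm_lyapunov_residual_le_of_log_le hL hM hlQ.le hm0 ?_ hm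
    have hcond : 0 ≤ condNumber (L * Lᵀ) * frobNorm (P + Q) :=
      mul_nonneg (mul_nonneg (specNorm_nonneg _) (specNorm_nonneg _)) (frobNorm_nonneg _)
    rw [frobNorm_neg, mul_assoc, div_mul_cancel₀ _ hlQ.ne']
    exact le_mul_of_one_le_left hcond (le_add_of_nonneg_right (Real.sqrt_nonneg 2))
  have hEH : E.IsHermitian := by
    refine hPQ.sub ?_
    rw [Matrix.isHermitian_iff_isSymm] at hZ ⊢
    simp [Matrix.IsSymm, hZ.eq, add_comm]
  refine posSemidef_of_lyapunov_of_similar hL hM hZ ?_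
  have hrhs : -(Mᵀ * Z + Z * M) = P + (Q + E) := by
    rw [hE]
    abel
  rw [hrhs]
  exact hP.add (posSemidef_add_of_frobNorm_le_lambdaMin hQ.isHermitian hEH hle)

end Step

/-! ### Numerical range, stability, and the Sylvester equation -/

section Stability

theorem re_star_dotProduct_map_mulVec {ι : Type*} [Fintype ι] (N : Matrix ι ι ℝ) (z : ι → ℂ) :
    (star z ⬝ᵥ (N.map Complex.ofReal *ᵥ z)).re =
      (fun i => (z i).re) ⬝ᵥ N *ᵥ (fun i => (z i).re) +
        (fun i => (z i).im) ⬝ᵥ N *ᵥ (fun i => (z i).im) := by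
  simp [dotProduct, Matrix.mulVec, Complex.re_sum, Complex.im_sum, Finset.sum_add_distrib]

theorem IsStrictlyDissipative.re_star_dotProduct_mulVec_neg {ι : Type*} [Fintype ι]
    {N : Matrix ι ι ℝ} (hN : IsStrictlyDissipative N) {z : ι → ℂ} (hz : z ≠ 0) :
    (star z ⬝ᵥ (N.map Complex.ofReal *ᵥ z)).re < 0 := by
  rw [re_star_dotProduct_map_mulVec]
  by_cases hre : (fun i => (z i).re) = 0
  · have him : (fun i => (z i).im) ≠ 0 := fun him =>
      hz (funext fun i => Complex.ext (congrFun hre i) (congrFun him i))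
    exact add_neg_of_nonpos_of_neg (hN.dotProduct_mulVec_nonpos _) (hN _ him)
  · exact add_neg_of_neg_of_nonpos (hN _ hre) (hN.dotProduct_mulVec_nonpos _)

theorem semiconjBy_aeval {R S : Type*} [CommSemiring R] [Semiring S] [Algebra R S] {a x y : S}
    (h : SemiconjBy a x y) (p : Polynomial R) :
    SemiconjBy a (Polynomial.aeval x p) (Polynomial.aeval y p) := by
  induction p using Polynomial.induction_on' with
  | add p q hp hq => simpa only [map_add] using hp.add_right hq
  | monomial k c =>
    simpa only [Polynomial.aeval_monomial] using
      SemiconjBy.mul_right (Algebra.commutes c a).symm (h.pow_right k)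

theorem eq_zero_of_mul_eq_mul_of_disjoint_spectrum {ι K : Type*} [Fintype ι] [DecidableEq ι]
    [Field K] [IsAlgClosed K] {M N D : Matrix ι ι K} (h : D * N = M * D)
    (hMN : Disjoint (spectrum K M) (spectrum K N)) : D = 0 := by
  rcases isEmpty_or_nonempty ι with hι | hι
  · exact Subsingleton.elim _ _
  have hunit : IsUnit (Polynomial.aeval M N.charpoly) := by
    have hdeg : 0 < N.charpoly.degree := by
      rw [Matrix.charpoly_degree_eq_dim]
      exact_mod_cast Fintype.card_pos
    rw [← not_not (a := IsUnit _), ← spectrum.zero_mem_iff K,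
      spectrum.map_polynomial_aeval_of_degree_pos _ _ hdeg]
    rintro ⟨μ, hμM, hμN⟩
    exact hMN.ne_of_mem hμM (Matrix.mem_spectrum_iff_isRoot_charpoly.2 hμN) rfl
  have hzero : Polynomial.aeval M N.charpoly * D = 0 := by
    rw [← (semiconjBy_aeval (show SemiconjBy D N M from h) N.charpoly).eq,
      Matrix.aeval_self_charpoly, mul_zero]
  exact hunit.mul_right_eq_zero.1 hzero

variable {n : ℕ}

theorem isStrictlyDissipative_of_numericalRange {N : Matrix (Fin n) (Fin n) ℝ}
    (h : ∀ z ∈ numericalRange N, z.re < 0) : IsStrictlyDissipative N := by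
  intro v hv
  have hc : 0 < (vecNorm v)⁻¹ := inv_pos.2 (vecNorm_pos hv)
  set c := (vecNorm v)⁻¹
  have hnorm : ‖WithLp.toLp 2 fun i => ((c * v i : ℝ) : ℂ)‖ = 1 := by
    calc ‖WithLp.toLp 2 fun i => ((c * v i : ℝ) : ℂ)‖ = ‖c • WithLp.toLp 2 v‖ := by
          simp [EuclideanSpace.norm_eq]
      _ = 1 := by
          rw [norm_smul, Real.norm_of_nonneg hc.le, ← vecNorm_eq_norm_toLp]
          exact inv_mul_cancel₀ (vecNorm_pos hv).ne'
  have hneg := h _ ⟨_, hnorm, rfl⟩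
  rw [re_star_dotProduct_map_mulVec] at hneg
  have hform : c * (c * (v ⬝ᵥ N *ᵥ v)) < 0 := by
    simpa [← Pi.smul_def, ← smul_eq_mul, Matrix.mulVec_smul, ← Pi.zero_def] using hneg
  exact neg_of_mul_neg_right (neg_of_mul_neg_right hform hc.le) hc.le

theorem IsStrictlyDissipative.isStable {N : Matrix (Fin n) (Fin n) ℝ}
    (hN : IsStrictlyDissipative N) : IsStable N := by
  intro μ hμ
  rw [← Matrix.spectrum_toLin', ← Module.End.hasEigenvalue_iff_mem_spectrum] at hμ
  obtain ⟨z, hz⟩ := hμ.exists_hasEigenvector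
  have hNz : N.map Complex.ofReal *ᵥ z = μ • z := by simpa using hz.apply_eq_smul
  have hzz : star z ⬝ᵥ z = ((∑ i, ‖z i‖ ^ 2 : ℝ) : ℂ) := by
    simp [dotProduct, Complex.conj_mul']
  have hneg := hN.re_star_dotProduct_mulVec_neg hz.2
  rw [hNz, dotProduct_smul, hzz, smul_eq_mul, Complex.re_mul_ofReal] at hneg
  exact neg_of_mul_neg_left hneg (by positivity)

theorem isStable_of_isStable_conj {M L : Matrix (Fin n) (Fin n) ℝ} (hL : IsUnit L.det)
    (h : IsStable (L⁻¹ * M * L)) : IsStable M := by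
  have hchar : (L⁻¹ * M * L).charpoly = M.charpoly := by
    rw [Matrix.charpoly_mul_comm, Matrix.mul_nonsing_inv_cancel_left _ _ hL]
  intro μ hμ
  refine h μ ?_
  rw [Matrix.mem_spectrum_iff_isRoot_charpoly] at hμ ⊢
  rw [show (Complex.ofReal : ℝ → ℂ) = Complex.ofRealHom from rfl, Matrix.charpoly_map] at hμ ⊢
  rwa [hchar]

theorem isStable_closedLoop {A L X : Matrix (Fin n) (Fin n) ℝ} (hL : IsUnit L.det)
    (hA : IsStrictlyDissipative (L⁻¹ * A * L)) (hX : X.PosSemidef) :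
    IsStable (A - L * Lᵀ * X) :=
  isStable_of_isStable_conj hL (isStrictlyDissipative_closedLoop hL hA hX).isStable

theorem IsStable.eq_zero_of_sylvester {M N D : Matrix (Fin n) (Fin n) ℝ} (hM : IsStable M)
    (hN : IsWeaklyStable N) (h : Mᵀ * D + D * N = 0) : D = 0 := by
  set φ : Matrix (Fin n) (Fin n) ℝ →+* Matrix (Fin n) (Fin n) ℂ := Complex.ofRealHom.mapMatrix
  have hφ : φ D * φ N = -(φ M)ᵀ * φ D := by
    rw [neg_mul, eq_neg_iff_add_eq_zero, add_comm]
    calc (φ M)ᵀ * φ D + φ D * φ N = φ (Mᵀ * D + D * N) := by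
          rw [map_add, map_mul, map_mul]
          rfl
      _ = 0 := by rw [h, map_zero]
  have hdisj : Disjoint (spectrum ℂ (-(φ M)ᵀ)) (spectrum ℂ (φ N)) := by
    refine Set.disjoint_left.2 fun μ hμM hμN => ?_
    rw [← spectrum.neg_eq, Set.mem_neg, Matrix.mem_spectrum_iff_isRoot_charpoly,
      Matrix.charpoly_transpose, ← Matrix.mem_spectrum_iff_isRoot_charpoly] at hμM
    have hpos : 0 < μ.re := by simpa using hM _ hμM
    exact (hN μ hμN).not_gt hpos
  exact Matrix.map_injective Complex.ofReal_injective <|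
    (eq_zero_of_mul_eq_mul_of_disjoint_spectrum hφ hdisj).trans (map_zero φ).symm

end Stability

/-! ### Solutions of the Riccati equation -/

section Solutions

variable {n : ℕ}

theorem eq_of_residual_eq_zero {A F Q X Y : Matrix (Fin n) (Fin n) ℝ} (hF : F.IsSymm)
    (hX : X.IsSymm) (hRX : residual A F Q X = 0) (hRY : residual A F Q Y = 0)
    (hsX : IsStable (A - F * X)) (hsY : IsWeaklyStable (A - F * Y)) : Y = X := by
  have hdiff : (A - F * X)ᵀ * (Y - X) + (Y - X) * (A - F * Y) =
      residual A F Q Y - residual A F Q X := by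
    rw [Matrix.transpose_sub, Matrix.transpose_mul, hF.eq, hX.eq, residual, residual]
    noncomm_ring
  refine sub_eq_zero.1 (hsX.eq_zero_of_sylvester hsY ?_)
  rw [hdiff, hRX, hRY, sub_zero]

theorem posDef_of_residual_eq_zero {A F Q X : Matrix (Fin n) (Fin n) ℝ} (hQ : Q.PosDef)
    (hX : X.PosSemidef) (hR : residual A F Q X = 0) : X.PosDef := by
  have hXT : Xᵀ = X := Matrix.isHermitian_iff_isSymm.1 hX.isHermitian
  refine .of_dotProduct_mulVec_pos hX.isHermitian fun v hv => ?_
  refine (hX.dotProduct_mulVec_nonneg v).lt_of_ne' fun h0 => ?_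
  have hXv : X *ᵥ v = 0 := (hX.dotProduct_mulVec_zero_iff v).1 h0
  have hform : v ⬝ᵥ residual A F Q X *ᵥ v = v ⬝ᵥ Q *ᵥ v := by
    simp only [residual, Matrix.add_mulVec, Matrix.sub_mulVec, ← Matrix.mulVec_mulVec, hXv,
      Matrix.mulVec_zero, zero_add, sub_zero, dotProduct_add]
    rw [← hXT, Matrix.dotProduct_transpose_mulVec, hXv, dotProduct_zero, zero_add]
  have hQv := hQ.dotProduct_mulVec_pos hv
  rw [star_trivial, ← hform, hR, Matrix.zero_mulVec, dotProduct_zero] at hQv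
  exact hQv.false

theorem transpose_mul_self_eq_of_residual {A L Q X : Matrix (Fin n) (Fin n) ℝ}
    (hL : IsUnit L.det) (hX : X.IsSymm) :
    (Lᵀ * X - L⁻¹ * A)ᵀ * (Lᵀ * X - L⁻¹ * A) =
      (L⁻¹ * A)ᵀ * (L⁻¹ * A) + Q - residual A (L * Lᵀ) Q X := by
  have hLB : L * (L⁻¹ * A) = A := Matrix.mul_nonsing_inv_cancel_left _ _ hL
  generalize L⁻¹ * A = B at hLB ⊢
  subst hLB
  rw [residual, Matrix.transpose_sub, Matrix.transpose_mul, Matrix.transpose_mul,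
    Matrix.transpose_transpose, hX.eq]
  noncomm_ring

open scoped Matrix.Norms.L2Operator in
theorem specNorm_le_of_residual {A L Q X : Matrix (Fin n) (Fin n) ℝ} (hL : IsUnit L.det)
    (hX : X.IsSymm) :
    specNorm X ≤ specNorm (Lᵀ)⁻¹ * (√(specNorm ((L⁻¹ * A)ᵀ * (L⁻¹ * A) + Q) +
      specNorm (residual A (L * Lᵀ) Q X)) + specNorm (L⁻¹ * A)) := by
  set B := L⁻¹ * A
  set W := Lᵀ * X - B
  have hW : specNorm W ≤ √(specNorm (Bᵀ * B + Q) + specNorm (residual A (L * Lᵀ) Q X)) := by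
    refine Real.le_sqrt_of_sq_le ?_
    rw [← specNorm_transpose_mul_self, transpose_mul_self_eq_of_residual hL hX (Q := Q)]
    exact norm_sub_le (Bᵀ * B + Q) (residual A (L * Lᵀ) Q X)
  have hXW : X = (Lᵀ)⁻¹ * (W + B) := by
    rw [sub_add_cancel, Matrix.nonsing_inv_mul_cancel_left _ _ (by rwa [Matrix.det_transpose])]
  calc specNorm X ≤ specNorm (Lᵀ)⁻¹ * (specNorm W + specNorm B) := by
        conv_lhs => rw [hXW]
        exact (Matrix.l2_opNorm_mul (Lᵀ)⁻¹ (W + B)).trans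
          (mul_le_mul_of_nonneg_left (norm_add_le W B) (norm_nonneg _))
    _ ≤ _ := by
        gcongr
        exact specNorm_nonneg _

theorem isClosed_setOf_posSemidef :
    IsClosed {X : Matrix (Fin n) (Fin n) ℝ | X.PosSemidef} := by
  simp only [Matrix.posSemidef_iff_dotProduct_mulVec, Matrix.IsHermitian, Set.ofPred_and,
    Set.ofPred_forall]
  exact (isClosed_eq (by fun_prop) (by fun_prop)).inter
    (isClosed_iInter fun v => isClosed_le continuous_const (by fun_prop))

open scoped Matrix.Norms.L2Operator in
theorem continuous_specNorm : Continuous (specNorm : Matrix (Fin n) (Fin n) ℝ → ℝ) :=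
  continuous_norm (E := Matrix (Fin n) (Fin n) ℝ)

theorem continuous_residual (A F Q : Matrix (Fin n) (Fin n) ℝ) : Continuous (residual A F Q) := by
  unfold residual
  fun_prop

open scoped Matrix.Norms.L2Operator in
theorem isCompact_setOf_posSemidef_and_specNorm_residual_le {L : Matrix (Fin n) (Fin n) ℝ}
    (hL : IsUnit L.det) (A Q : Matrix (Fin n) (Fin n) ℝ) (c : ℝ) :
    IsCompact {X | X.PosSemidef ∧ specNorm (residual A (L * Lᵀ) Q X) ≤ c} := by
  have : ProperSpace (Matrix (Fin n) (Fin n) ℝ) := FiniteDimensional.proper_real _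
  set B := L⁻¹ * A
  refine (isCompact_closedBall (0 : Matrix (Fin n) (Fin n) ℝ)
    (specNorm (Lᵀ)⁻¹ * (√(specNorm (Bᵀ * B + Q) + c) + specNorm B))).of_isClosed_subset
    (isClosed_setOf_posSemidef.inter <|
      isClosed_le (continuous_specNorm.comp (continuous_residual A _ Q)) continuous_const) ?_
  rintro X ⟨hX, hc⟩
  rw [mem_closedBall_zero_iff]
  refine (specNorm_le_of_residual hL (Matrix.isHermitian_iff_isSymm.1 hX.isHermitian)
    (A := A) (Q := Q)).trans ?_
  gcongr
  exact specNorm_nonneg _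

theorem exists_stabilizing_limit {A L Q : Matrix (Fin n) (Fin n) ℝ} (hQ : Q.PosDef)
    (hL : IsUnit L.det) (hA : IsStrictlyDissipative (L⁻¹ * A * L))
    {X : ℕ → Matrix (Fin n) (Fin n) ℝ} (hX : ∀ k, (X k).PosSemidef)
    (hR : Tendsto (fun k => residual A (L * Lᵀ) Q (X k)) atTop (𝓝 0)) :
    ∃ Xstar : Matrix (Fin n) (Fin n) ℝ, Xstar.PosDef ∧ residual A (L * Lᵀ) Q Xstar = 0 ∧
      IsStable (A - L * Lᵀ * Xstar) ∧
      (∀ Y : Matrix (Fin n) (Fin n) ℝ, residual A (L * Lᵀ) Q Y = 0 →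
        IsWeaklyStable (A - L * Lᵀ * Y) → Y = Xstar) ∧
      Tendsto X atTop (𝓝 Xstar) := by
  have hK := isCompact_setOf_posSemidef_and_specNorm_residual_le hL A Q 1
  set K := {X | X.PosSemidef ∧ specNorm (residual A (L * Lᵀ) Q X) ≤ 1}
  have hmem : ∀ᶠ k in atTop, X k ∈ K := by
    have hnorm := (continuous_specNorm.tendsto 0).comp hR
    have hlt : specNorm (0 : Matrix (Fin n) (Fin n) ℝ) < 1 := by simp [specNorm]
    filter_upwards [hnorm.eventually_le_const hlt] with k hk using ⟨hX k, hk⟩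
  have hzero {Z : Matrix (Fin n) (Fin n) ℝ} (hZ : MapClusterPt Z atTop X) :
      residual A (L * Lᵀ) Q Z = 0 := by
    have hcluster := hZ.continuousAt_comp (continuous_residual A (L * Lᵀ) Q).continuousAt
    have : NeBot (𝓝 (residual A (L * Lᵀ) Q Z) ⊓ 𝓝 0) :=
      NeBot.mono hcluster (inf_le_inf_left _ hR)
    exact eq_of_nhds_neBot this
  obtain ⟨Xstar, ⟨hpsd, -⟩, hcluster⟩ := hK.exists_mapClusterPt_of_frequently hmem.frequently
  have hstab := isStable_closedLoop hL hA hpsd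
  have huniq (Y : Matrix (Fin n) (Fin n) ℝ) (hRY : residual A (L * Lᵀ) Q Y = 0)
      (hY : IsWeaklyStable (A - L * Lᵀ * Y)) : Y = Xstar :=
    eq_of_residual_eq_zero (Matrix.isSymm_mul_transpose_self L)
      (Matrix.isHermitian_iff_isSymm.1 hpsd.isHermitian) (hzero hcluster) hRY hstab hY
  refine ⟨Xstar, posDef_of_residual_eq_zero hQ hpsd (hzero hcluster), hzero hcluster, hstab, huniq,
    hK.tendsto_nhds_of_unique_mapClusterPt hmem fun Z hZ hZcluster =>
      huniq Z (hzero hZcluster) fun μ hμ => (isStable_closedLoop hL hA hZ.1 μ hμ).le⟩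

end Solutions

/-! ### Convergence of the iteration -/

section Convergence

theorem tendsto_zero_of_le_one_sub_mul {r a : ℕ → ℝ} (hr : ∀ k, 0 ≤ r k)
    (h : ∀ k, r (k + 1) ≤ (1 - a k) * r k)
    (ha : Tendsto (fun k => ∑ i ∈ Finset.range k, a i) atTop atTop) :
    Tendsto r atTop (𝓝 0) := by
  have hexp (k : ℕ) : r k ≤ Real.exp (-∑ i ∈ Finset.range k, a i) * r 0 := by
    induction k with
    | zero => simp
    | succ k ih =>
      calc r (k + 1) ≤ (1 - a k) * r k := h k
        _ ≤ Real.exp (-a k) * r k :=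
            mul_le_mul_of_nonneg_right (Real.one_sub_le_exp_neg _) (hr k)
        _ ≤ Real.exp (-a k) * (Real.exp (-∑ i ∈ Finset.range k, a i) * r 0) := by gcongr
        _ = Real.exp (-∑ i ∈ Finset.range (k + 1), a i) * r 0 := by
            rw [Finset.sum_range_succ, neg_add, Real.exp_add]
            ring
  refine squeeze_zero hr hexp ?_
  simpa using (Real.tendsto_exp_neg_atTop_nhds_zero.comp ha).mul_const (r 0)

theorem tendsto_sum_range_atTop {a : ℕ → ℝ} {δ : ℝ} (hδ : 0 < δ) (h : ∀ k, δ ≤ a k) :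
    Tendsto (fun k => ∑ i ∈ Finset.range k, a i) atTop atTop := by
  refine tendsto_atTop_mono (fun k => ?_) (tendsto_natCast_atTop_atTop.atTop_mul_const hδ)
  simpa using Finset.card_nsmul_le_sum (Finset.range k) a δ fun i _ => h i

variable {n : ℕ}

theorem continuous_frobNorm : Continuous (frobNorm : Matrix (Fin n) (Fin n) ℝ → ℝ) := by
  unfold frobNorm
  fun_prop

namespace IsNewtonKleinmanRun

variable {A L F Q : Matrix (Fin n) (Fin n) ℝ} {α : ℝ} {X Xhat : ℕ → Matrix (Fin n) (Fin n) ℝ}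
  {lam : ℕ → ℝ} {it : ℕ → ℕ}

theorem posSemidef (hrun : IsNewtonKleinmanRun A (L * Lᵀ) Q α X Xhat lam it) (hQ : Q.PosDef)
    (hL : IsUnit L.det) (hA : IsStrictlyDissipative (L⁻¹ * A * L)) (hX0 : (X 0).PosSemidef)
    (hit : ∀ k, gmresBound A (L * Lᵀ) Q L (X k) ≤ it k) (k : ℕ) : (X k).PosSemidef := by
  induction k with
  | zero => exact hX0
  | succ k ih =>
    have hhat := posSemidef_of_isGMRESIterate hQ hL hA ih (hrun.gmres k) (hit k)
    rw [hrun.update k]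
    exact (ih.smul (sub_nonneg.2 (hrun.step_mem k).2)).add (hhat.smul (hrun.step_mem k).1.le)

open scoped Matrix.Norms.L2Operator in
theorem tendsto_residual (hrun : IsNewtonKleinmanRun A F Q α X Xhat lam it) (hα : 0 < α)
    (hlam : Tendsto (fun k => ∑ i ∈ Finset.range k, lam i) atTop atTop) :
    Tendsto (fun k => residual A F Q (X k)) atTop (𝓝 0) := by
  refine tendsto_zero_iff_norm_tendsto_zero.2 <| tendsto_zero_of_le_one_sub_mul
    (a := fun k => lam k * α) (fun k => norm_nonneg _) (fun k => ?_) ?_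
  · rw [hrun.update k]
    exact hrun.line_search k
  · simpa only [Finset.sum_mul] using hlam.atTop_mul_const hα

end IsNewtonKleinmanRun

end Convergence

end Riccati

theorem corollary3p2_general {n : ℕ} (A F Q L : Matrix (Fin n) (Fin n) ℝ)
    (hF : F.PosDef) (hQ : Q.PosDef) (hFL : F = L * Lᵀ)
    (hW : ∀ z ∈ Riccati.numericalRange (L⁻¹ * A * L), z.re < 0)
    (X Xhat : ℕ → Matrix (Fin n) (Fin n) ℝ) (lam : ℕ → ℝ) (it : ℕ → ℕ)
    (α : ℝ) (hα : 0 < α) (hX0 : (X 0).PosSemidef)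
    (hrun : Riccati.IsNewtonKleinmanRun A F Q α X Xhat lam it)
    (hit : ∀ k, Riccati.gmresBound A F Q L (X k) ≤ (it k : ℝ))
    (hlam : Tendsto (fun k => ∑ i ∈ Finset.range k, lam i) atTop atTop) :
    Tendsto (fun k => Riccati.frobNorm (Riccati.residual A F Q (X k))) atTop (𝓝 0) ∧
    ∃ Xstar : Matrix (Fin n) (Fin n) ℝ,
      Xstar.PosDef ∧
      Riccati.residual A F Q Xstar = 0 ∧
      Riccati.IsStable (A - F * Xstar) ∧
      (∀ Y : Matrix (Fin n) (Fin n) ℝ, Riccati.residual A F Q Y = 0 →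
        Riccati.IsWeaklyStable (A - F * Y) → Y = Xstar) ∧
      Tendsto X atTop (𝓝 Xstar) := by
  subst hFL
  have hL : IsUnit L.det := by
    have hdet := (Matrix.isUnit_iff_isUnit_det _).1 hF.isUnit
    rw [Matrix.det_mul] at hdet
    exact isUnit_of_mul_isUnit_left hdet
  have hA := Riccati.isStrictlyDissipative_of_numericalRange hW
  have hX := hrun.posSemidef hQ hL hA hX0 hit
  have hR := hrun.tendsto_residual hα hlam
  refine ⟨?_, Riccati.exists_stabilizing_limit hQ hL hA hX hR⟩
  have hnorm := (Riccati.continuous_frobNorm.tendsto 0).comp hR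
  rwa [show Riccati.frobNorm (0 : Matrix (Fin n) (Fin n) ℝ) = 0 by simp [Riccati.frobNorm]]
    at hnorm

theorem corollary3p2 {n : ℕ} (A F Q L : Matrix (Fin n) (Fin n) ℝ)
    (hF : F.PosDef) (hQ : Q.PosDef)
    (hL : Riccati.IsCholeskyFactor F L)
    (hW : ∀ z ∈ Riccati.numericalRange (L⁻¹ * A * L), z.re < 0)
    (X Xhat : ℕ → Matrix (Fin n) (Fin n) ℝ) (lam : ℕ → ℝ) (it : ℕ → ℕ)
    (α : ℝ) (hα : 0 < α)
    (hX0 : (X 0).PosSemidef) (hstable0 : Riccati.IsStable (A - F * X 0))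
    (hrun : Riccati.IsNewtonKleinmanRun A F Q α X Xhat lam it)
    (hit : ∀ k, Riccati.gmresBound A F Q L (X k) ≤ (it k : ℝ))
    (hlam : ∃ lamBar : ℝ, 0 < lamBar ∧ ∀ k, lamBar ≤ lam k) :
    Tendsto (fun k => Riccati.frobNorm (Riccati.residual A F Q (X k))) atTop (𝓝 0) ∧
    ∃ Xstar : Matrix (Fin n) (Fin n) ℝ,
      Xstar.PosDef ∧
      Riccati.residual A F Q Xstar = 0 ∧
      Riccati.IsStable (A - F * Xstar) ∧
      (∀ Y : Matrix (Fin n) (Fin n) ℝ, Riccati.residual A F Q Y = 0 →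
        Riccati.IsWeaklyStable (A - F * Y) → Y = Xstar) ∧
      Tendsto X atTop (𝓝 Xstar) := by
  obtain ⟨lamBar, hpos, hle⟩ := hlam
  exact corollary3p2_general A F Q L hF hQ hL.eq hW X Xhat lam it α hα hX0 hrun hit
    (Riccati.tendsto_sum_range_atTop hpos hle)
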